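/- Let $G=(V,E)$ be a finite simple graph. Its Ore-degree is $\theta(G)=\max\{d(u)+d(v): uv\in E\}$ (taken to be $0$ if $E=\emptyset$), and its maximum average degree $\mathrm{mad}(G)$ is the maximum, over all subgraphs $G'$ of $G$ with at least one vertex, of the average degree $\frac{1}{|V(G')|}\sum_{v\in V(G')}d_{G'}(v)$ (taken to be $0$ if $V=\emptyset$). Two edges of $G$ see each other if their distance in the line graph of $G$ is $1$ or $2$, that is, if they are distinct and either share an end or are joined by an edge of $G$. The strong chromatic index $\chi_s'(G)$ is the least $k$ for which the edges of $G$ can be colored with $k$ colors so that any two edges that see each other get distinct colors. If $\theta(G)\le 7$ and $\mathrm{mad}(G)<\frac{34}{11}$, then $\chi_s'(G)\le 13$. -/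

import Mathlib

namespace SimpleGraph

/-- The average degree of a finite graph: the sum of the degrees divided by the number of
vertices. -/
noncomputable def avgDegree {V : Type*} [Fintype V] (G : SimpleGraph V) [DecidableRel G.Adj] : ℝ :=
  (∑ v : V, (G.degree v : ℝ)) / (Fintype.card V : ℝ)

open Classical in
/-- The maximum average degree of a finite graph: the largest average degree of a subgraph with at
least one vertex. There are only finitely many subgraphs, so that the supremum is a maximum
(it is `0` for the graph without vertices). -/
noncomputable def mad {V : Type*} [Fintype V] (G : SimpleGraph V) : ℝ :=
  ⨆ H : {H : G.Subgraph // H.verts.Nonempty}, H.1.coe.avgDegree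

/-- The Ore-degree of a finite graph: the maximum of `d(u) + d(v)` over the edges `uv`
(it is `0` for a graph without edges). -/
def oreDegree {V : Type*} [Fintype V] (G : SimpleGraph V) [DecidableRel G.Adj] : ℕ :=
  (Finset.univ.filter fun p : V × V => G.Adj p.1 p.2).sup fun p => G.degree p.1 + G.degree p.2

/-- The graph on the edges of `G` in which two edges are adjacent if they see each other, that is,
if their distance in the line graph of `G` is `1` or `2`. (`SimpleGraph.dist` is `0` for edges in
different components, which do not see each other.) -/
def seesGraph {V : Type*} (G : SimpleGraph V) : SimpleGraph G.edgeSet where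
  Adj e f := G.lineGraph.dist e f = 1 ∨ G.lineGraph.dist e f = 2
  symm := ⟨fun e f h => by rwa [G.lineGraph.dist_comm]⟩
  loopless := ⟨fun e h => by simp at h⟩

/-- A strong `k`-edge-coloring: an assignment of `k` colors to the edges such that edges that see
each other get distinct colors. -/
abbrev StrongEdgeColoring {V : Type*} (G : SimpleGraph V) (k : ℕ) : Type _ :=
  G.seesGraph.Coloring (Fin k)

/-- The strong chromatic index: the least `k` such that `G` has a strong `k`-edge-coloring
(`⊤` if there is none, which does not happen for a finite graph). -/
noncomputable def strongChromaticIndex {V : Type*} (G : SimpleGraph V) : ℕ∞ :=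
  ⨅ k ∈ {k : ℕ | Nonempty (G.StrongEdgeColoring k)}, (k : ℕ∞)

end SimpleGraph

/-!
Suppose that some graph with Ore-degree at most `7`, all of whose subgraphs have average degree less
than `34 / 11`, has no strong edge-coloring with `13` colors, and let `G` be a minimal one. A coloring
of `G - v` is a proper partial coloring of the conflict graph of `G` (the graph of the pairs of edges
that see each other), so in `G` no such coloring extends to the edges at a vertex `v` that is not
isolated (`IsCritical`). An edge `uv` sees at most `D u + D v - d u - d v` edges, where `D` sums the
degrees of the neighbors, and fewer if it lies on a 4-cycle.

Coloring greedily the edges at a vertex `v` shows that if they see at most `13` edges each, they see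
exactly `13` each. This determines the surroundings of vertices of degree `2`: all degrees are at
least `2`, a vertex of degree `2` has neighbors of degree at least `4`, and a vertex of degree `4` has
at most one neighbor of degree `2`. Two configurations are excluded by the argument of Brooks'
theorem (`ExtendableSaving.extendable`), which saves a color at an edge by coloring two nonadjacent
neighbors of it in the conflict graph first: vertices of degree `5` (`degree_le_four`), and a vertex
`v` of degree `3` all of whose neighbors have degree `3` and exactly one neighbor of degree `4`, one
of which has a neighbor of degree `2` (`two_le_fourCount_of_adj`).

The remaining degrees are `2`, `3` and `4`, and discharging shows that the average degree is at least
`34 / 11`, a contradiction. In units in which a vertex of degree `d` starts with the charge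
`3 (11 d - 34)`, a vertex of degree `4` gives `18` to its neighbor of degree `2`, if there
is one, and then `4`, otherwise `5`, to each neighbor of degree `3`. The vertices of degree `3`
without neighbors of degree `4` live on what their neighbors pass on (`transfer`).
-/

namespace SimpleGraph

/-! ### Extending partial colorings -/

section Extension

open scoped Classical

variable {E α : Type*} {H : SimpleGraph E}

/-- The assignment `c` is a proper coloring of `H` outside the set `U` of elements that are regarded
as uncolored; its values on `U` are irrelevant. -/
def ProperOff (H : SimpleGraph E) (U : Finset E) (c : E → α) : Prop :=
  ∀ e f, e ∉ U → f ∉ U → H.Adj e f → c e ≠ c f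

/-- If some proper coloring of `H` outside `U` with colors in `α` exists, then all of `H` can be
colored. The coloring outside `U` may be changed, so this property passes to subsets of `U`. -/
def Extendable (H : SimpleGraph E) (α : Type*) (U : Finset E) : Prop :=
  ∀ c : E → α, H.ProperOff U c → Nonempty (H.Coloring α)

/-- The variant of `Extendable` for colorings outside `U` in which two neighbors of `p` share a
color, so that `p` can afford one more neighbor than in a greedy coloring. -/
def ExtendableSaving (H : SimpleGraph E) (α : Type*) (p : E) (U : Finset E) : Prop :=
  ∀ c : E → α, H.ProperOff U c →
    (∃ e f, H.Adj p e ∧ H.Adj p f ∧ e ∉ U ∧ f ∉ U ∧ e ≠ f ∧ c e = c f) → Nonempty (H.Coloring α)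

lemma ProperOff.mono {U U' : Finset E} {c : E → α} (h : H.ProperOff U c) (hU : U ⊆ U') :
    H.ProperOff U' c :=
  fun e f he hf => h e f (fun h' => he (hU h')) (fun h' => hf (hU h'))

lemma Extendable.mono {U U' : Finset E} (h : H.Extendable α U') (hU : U ⊆ U') :
    H.Extendable α U :=
  fun c hc => h c (hc.mono hU)

lemma extendable_empty : H.Extendable α ∅ :=
  fun c hc => ⟨Coloring.mk c fun {e f} h => hc e f (by simp) (by simp) h⟩

lemma exists_color [Fintype α] {S : Finset E} (c : E → α) (hS : (S.image c).card < Fintype.card α) :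
    ∃ x, ∀ f ∈ S, c f ≠ x := by
  obtain ⟨x, hx⟩ := Finset.exists_mem_notMem_of_card_lt_card (t := Finset.univ) (s := S.image c)
    (by simpa using hS)
  exact ⟨x, fun f hf h => hx.2 (Finset.mem_image.2 ⟨f, hf, h⟩)⟩

variable [DecidableEq E]

lemma ProperOff.update {U : Finset E} {c : E → α} {e : E} {x : α}
    (h : H.ProperOff (insert e U) c)
    (hx : ∀ f, H.Adj e f → f ∉ insert e U → c f ≠ x) :
    H.ProperOff U (Function.update c e x) := by
  intro f g hf hg hfg
  by_cases hfe : f = e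
  · subst hfe
    have hgf : g ≠ f := hfg.ne'
    rw [Function.update_self, Function.update_of_ne hgf]
    exact (hx g hfg (by simp [hgf, hg])).symm
  · by_cases hge : g = e
    · subst hge
      rw [Function.update_self, Function.update_of_ne hfe]
      exact hx f hfg.symm (by simp [hfe, hf])
    · rw [Function.update_of_ne hfe, Function.update_of_ne hge]
      exact h f g (by simp [hfe, hf]) (by simp [hge, hg]) hfg

variable [Fintype α] [Fintype E]

lemma Extendable.insert {U : Finset E} {e : E} (h : H.Extendable α U)
    (he : (H.neighborFinset e \ insert e U).card < Fintype.card α) :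
    H.Extendable α (insert e U) := by
  intro c hc
  obtain ⟨x, hx⟩ := exists_color c (Finset.card_image_le.trans_lt he)
  exact h _ (hc.update (x := x) fun f hf hfU => hx f (by simpa [hf] using hfU))

lemma ExtendableSaving.insert {U : Finset E} {p e : E} (h : H.ExtendableSaving α p U)
    (he : (H.neighborFinset e \ insert e U).card < Fintype.card α) :
    H.ExtendableSaving α p (insert e U) := by
  rintro c hc ⟨f, g, hf, hg, hfU, hgU, hfg, hcfg⟩
  obtain ⟨x, hx⟩ := exists_color c (Finset.card_image_le.trans_lt he)
  rw [Finset.mem_insert, not_or] at hfU hgU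
  refine h _ (hc.update (x := x) fun f hf hfU => hx f (by simpa [hf] using hfU))
    ⟨f, g, hf, hg, hfU.2, hgU.2, hfg, ?_⟩
  rwa [Function.update_of_ne hfU.1, Function.update_of_ne hgU.1]

lemma extendableSaving_singleton {p : E} (hp : H.degree p ≤ Fintype.card α) :
    H.ExtendableSaving α p {p} := by
  rintro c hc ⟨f, g, hf, hg, -, -, hfg, hcfg⟩
  have hcard : ((H.neighborFinset p).image c).card < Fintype.card α := by
    -- the neighbor `f` can be left out, since `g` has the same color
    have himage : (H.neighborFinset p).image c = ((H.neighborFinset p).erase f).image c := by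
      ext x
      simp only [Finset.mem_image, Finset.mem_erase, mem_neighborFinset]
      constructor
      · rintro ⟨e, he, rfl⟩
        by_cases hef : e = f
        · exact ⟨g, ⟨hfg.symm, hg⟩, by rw [hef, hcfg]⟩
        · exact ⟨e, ⟨hef, he⟩, rfl⟩
      · rintro ⟨e, he, rfl⟩
        exact ⟨e, he.2, rfl⟩
    have hmem : f ∈ H.neighborFinset p := by simpa using hf
    have hpos := Finset.card_pos.2 ⟨f, hmem⟩
    have h1 := Finset.card_image_le (s := (H.neighborFinset p).erase f) (f := c)
    rw [Finset.card_erase_of_mem hmem] at h1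
    rw [card_neighborFinset_eq_degree] at h1 hpos
    rw [himage]
    omega
  obtain ⟨x, hx⟩ := exists_color c hcard
  refine extendable_empty _ (ProperOff.update (U := ∅) (by simpa using hc) (x := x) ?_)
  exact fun e he _ => hx e (by simpa using he)

lemma card_sdiff_insert_lt {R : Finset E} {k : ℕ} {p r : E} (hp : H.Adj p r) (hpR : p ∈ R)
    (hr : H.degree r ≤ k) : (H.neighborFinset r \ insert r R).card < k := by
  refine lt_of_lt_of_le (Finset.card_lt_card ?_) hr
  refine Finset.ssubset_iff_subset_ne.2 ⟨Finset.sdiff_subset, fun h => ?_⟩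
  have : p ∈ H.neighborFinset r := by simpa using hp.symm
  rw [← h] at this
  simp [hpR] at this

/-- The elements of `R` can be colored greedily as long as their common neighbor `p` is
uncolored. -/
lemma extendable_insert_of_apex {p : E} {R : Finset E} (hp : H.degree p < Fintype.card α)
    (hR : ∀ r ∈ R, H.Adj p r ∧ H.degree r ≤ Fintype.card α) :
    H.Extendable α (insert p R) := by
  induction R using Finset.induction_on with
  | empty =>
    exact extendable_empty.insert ((Finset.card_le_card Finset.sdiff_subset).trans_lt hp)
  | insert r R hr ih =>
    rw [Finset.insert_comm]
    have hr' := hR r (by simp)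
    exact (ih fun s hs => hR s (by simp [hs])).insert
      (card_sdiff_insert_lt hr'.1 (by simp) hr'.2)

lemma extendableSaving_insert_of_apex {p : E} {R : Finset E} (hp : H.degree p ≤ Fintype.card α)
    (hR : ∀ r ∈ R, H.Adj p r ∧ H.degree r ≤ Fintype.card α) :
    H.ExtendableSaving α p (insert p R) := by
  induction R using Finset.induction_on with
  | empty => simpa using extendableSaving_singleton hp
  | insert r R hr ih =>
    rw [Finset.insert_comm]
    have hr' := hR r (by simp)
    exact (ih fun s hs => hR s (by simp [hs])).insert
      (card_sdiff_insert_lt hr'.1 (by simp) hr'.2)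

/-- The coloring step of Brooks' theorem: two nonadjacent neighbors `a` and `b` of `p` can be colored
such that two neighbors of `p` share a color. Either the lists of available colors of `a` and `b`
meet, or, being too large together to fit into the list of `p`, one of them contains a color that
already occurs around `p`. -/
lemma ExtendableSaving.extendable {p a b : E} {U F : Finset E} (h : H.ExtendableSaving α p U)
    (hF : F = Insert.insert a (Insert.insert b U))
    (haU : a ∉ U) (hbU : b ∉ U) (hab : a ≠ b) (hnab : ¬ H.Adj a b) (hpa : H.Adj p a)
    (hpb : H.Adj p b) (ha : (H.neighborFinset a \ F).card < Fintype.card α)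
    (hb : (H.neighborFinset b \ F).card < Fintype.card α)
    (hcard : (H.neighborFinset a \ F).card + (H.neighborFinset b \ F).card <
      (H.neighborFinset p \ F).card + Fintype.card α) :
    H.Extendable α F := by
  intro c hc
  have hnba : ¬ H.Adj b a := fun h => hnab h.symm
  have key : ∀ x y, (∀ f ∈ H.neighborFinset a \ F, c f ≠ x) →
      (∀ f ∈ H.neighborFinset b \ F, c f ≠ y) →
      H.ProperOff U (Function.update (Function.update c a x) b y) := by
    intro x y hx hy
    refine ProperOff.update (ProperOff.update (hF ▸ hc) fun f hf hfF => ?_) fun f hf hfF => ?_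
    · exact hx f (by simp only [Finset.mem_sdiff, mem_neighborFinset]; exact ⟨hf, hF ▸ hfF⟩)
    · have hfa : f ≠ a := fun h => hnba (h ▸ hf)
      rw [Function.update_of_ne hfa]
      refine hy f ?_
      simp only [Finset.mem_sdiff, mem_neighborFinset, hF, Finset.mem_insert, not_or]
      rw [Finset.mem_insert, not_or] at hfF
      exact ⟨hf, hfa, hfF⟩
  have old : ∀ x y, ∀ f ∉ F, Function.update (Function.update c a x) b y f = c f := by
    intro x y f hf
    simp only [hF, Finset.mem_insert, not_or] at hf
    rw [Function.update_of_ne hf.2.1, Function.update_of_ne hf.1]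
  have vala : ∀ x y, Function.update (Function.update c a x) b y a = x := by
    intro x y
    rw [Function.update_of_ne hab, Function.update_self]
  have valb : ∀ x y, Function.update (Function.update c a x) b y b = y := by
    intro x y
    rw [Function.update_self]
  obtain ⟨xa, hxa⟩ := exists_color c (Finset.card_image_le.trans_lt ha)
  obtain ⟨xb, hxb⟩ := exists_color c (Finset.card_image_le.trans_lt hb)
  have notU : ∀ f ∉ F, f ∉ U := fun f hf hfU => hf (by simp [hF, hfU])
  have haF : a ∈ F := by simp [hF]
  have hbF : b ∈ F := by simp [hF]
  by_cases hinj : Set.InjOn c (H.neighborFinset p \ F : Finset E)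
  swap
  · simp only [Set.InjOn, not_forall] at hinj
    obtain ⟨f, hf, g, hg, hcfg, hfg⟩ := hinj
    simp only [Finset.coe_sdiff, Set.mem_sdiff, Finset.mem_coe, mem_neighborFinset] at hf hg
    refine h _ (key xa xb hxa hxb)
      ⟨f, g, hf.1, hg.1, notU f hf.2, notU g hg.2, hfg, ?_⟩
    rw [old _ _ f hf.2, old _ _ g hg.2, hcfg]
  set La : Finset α := ((H.neighborFinset a \ F).image c)ᶜ with hLa
  set Lb : Finset α := ((H.neighborFinset b \ F).image c)ᶜ with hLb
  set Lp : Finset α := ((H.neighborFinset p \ F).image c)ᶜ with hLp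
  have memL : ∀ (q : E) (x : α), x ∈ ((H.neighborFinset q \ F).image c)ᶜ →
      ∀ f ∈ H.neighborFinset q \ F, c f ≠ x := by
    intro q x hx f hf hcf
    rw [Finset.mem_compl] at hx
    exact hx (Finset.mem_image.2 ⟨f, hf, hcf⟩)
  by_cases hdisj : Disjoint La Lb
  swap
  · obtain ⟨x, hx, hx'⟩ := Finset.not_disjoint_iff.1 hdisj
    exact h _ (key x x (memL a x hx) (memL b x hx'))
      ⟨a, b, hpa, hpb, haU, hbU, hab, by rw [vala, valb]⟩
  by_cases hsa : La ⊆ Lp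
  swap
  · obtain ⟨x, hx, hx'⟩ := Finset.not_subset.1 hsa
    rw [hLp, Finset.mem_compl, not_not] at hx'
    obtain ⟨f, hf, rfl⟩ := Finset.mem_image.1 hx'
    rw [Finset.mem_sdiff, mem_neighborFinset] at hf
    refine h _ (key (c f) xb (memL a _ hx) hxb)
      ⟨a, f, hpa, hf.1, haU, notU f hf.2, fun haf => hf.2 (haf ▸ haF), ?_⟩
    rw [vala, old _ _ f hf.2]
  by_cases hsb : Lb ⊆ Lp
  swap
  · obtain ⟨x, hx, hx'⟩ := Finset.not_subset.1 hsb
    rw [hLp, Finset.mem_compl, not_not] at hx'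
    obtain ⟨f, hf, rfl⟩ := Finset.mem_image.1 hx'
    rw [Finset.mem_sdiff, mem_neighborFinset] at hf
    refine h _ (key xa (c f) hxa (memL b _ hx))
      ⟨b, f, hpb, hf.1, hbU, notU f hf.2, fun hbf => hf.2 (hbf ▸ hbF), ?_⟩
    rw [valb, old _ _ f hf.2]
  exfalso
  have hle := Finset.card_le_card (Finset.union_subset hsa hsb)
  rw [Finset.card_union_of_disjoint hdisj, hLa, hLb, hLp, Finset.card_compl, Finset.card_compl,
    Finset.card_compl, Finset.card_image_of_injOn hinj] at hle
  have h1 := Finset.card_image_le (s := H.neighborFinset a \ F) (f := c)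
  have h2 := Finset.card_image_le (s := H.neighborFinset b \ F) (f := c)
  have h3 : (H.neighborFinset p \ F).card ≤ Fintype.card α := by
    rw [← Finset.card_image_of_injOn hinj]
    exact Finset.card_le_univ _
  omega

end Extension

/-! ### The conflict graph -/

section Conflict

variable {V : Type*}

/-- The graph of the pairs of edges of `G` that see each other, on the vertex set `Sym2 V`, which does
not depend on `G`; the elements of `Sym2 V` that are not edges of `G` are isolated. -/
def conflictGraph (G : SimpleGraph V) : SimpleGraph (Sym2 V) where
  Adj e f := e ≠ f ∧ e ∈ G.edgeSet ∧ f ∈ G.edgeSet ∧ ∃ x ∈ e, ∃ y ∈ f, x = y ∨ G.Adj x y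
  symm := ⟨fun _ _ ⟨hne, he, hf, x, hx, y, hy, h⟩ =>
    ⟨hne.symm, hf, he, y, hy, x, hx, h.imp Eq.symm fun h => h.symm⟩⟩
  loopless := ⟨fun _ h => h.1 rfl⟩

variable {G : SimpleGraph V}

lemma conflictGraph_adj_of_star {v u w : V} (hu : G.Adj v u) (hw : G.Adj v w) (huw : u ≠ w) :
    G.conflictGraph.Adj s(v, u) s(v, w) :=
  ⟨mt Sym2.congr_right.1 huw, hu, hw, v, by simp, v, by simp, Or.inl rfl⟩

lemma conflictGraph_adj_of_path {p x y q : V} (hpx : G.Adj p x) (hxy : G.Adj x y)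
    (hyq : G.Adj y q) (hpy : p ≠ y) : G.conflictGraph.Adj s(p, x) s(y, q) :=
  ⟨fun h => by
      have : y ∈ s(p, x) := h ▸ by simp
      rcases Sym2.mem_iff.1 this with h | h
      · exact hpy h.symm
      · exact hxy.ne h.symm, hpx, hyq, x, by simp, y, by simp, Or.inr hxy⟩

section Finite

open scoped Classical

variable [Fintype V]

/-- The sum of the degrees of the neighbors of `v`, that is, the number of walks of length two that
start at `v`. -/
noncomputable def nbrDegreeSum (G : SimpleGraph V) (v : V) : ℕ :=
  ∑ x ∈ G.neighborFinset v, G.degree x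

lemma conflictGraph_neighborFinset_subset {u v : V} (h : G.Adj u v) :
    G.conflictGraph.neighborFinset s(u, v) ⊆
      ((G.neighborFinset u).erase v).biUnion (fun x => G.incidenceFinset x) ∪
      ((G.neighborFinset v).erase u).biUnion (fun x => G.incidenceFinset x) := by
  have key : ∀ x ∈ s(u, v), ∀ y q, G.Adj y q → s(u, v) ≠ s(y, q) → (x = y ∨ G.Adj x y) →
      ∃ z, ((G.Adj u z ∧ z ≠ v) ∨ (G.Adj v z ∧ z ≠ u)) ∧ (z = y ∨ z = q) := by
    intro x hx y q hyq hne hxy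
    rcases Sym2.mem_iff.1 hx with rfl | rfl
    · rcases hxy with rfl | hxy
      · exact ⟨q, Or.inl ⟨hyq, fun h' => hne (by rw [h'])⟩, Or.inr rfl⟩
      · by_cases hy : y = v
        · subst hy
          exact ⟨q, Or.inr ⟨hyq, fun h' => hne (by rw [h', Sym2.eq_swap])⟩, Or.inr rfl⟩
        · exact ⟨y, Or.inl ⟨hxy, hy⟩, Or.inl rfl⟩
    · rcases hxy with rfl | hxy
      · exact ⟨q, Or.inr ⟨hyq, fun h' => hne (by rw [h', Sym2.eq_swap])⟩, Or.inr rfl⟩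
      · by_cases hy : y = u
        · subst hy
          exact ⟨q, Or.inl ⟨hyq, fun h' => hne (by rw [h'])⟩, Or.inr rfl⟩
        · exact ⟨y, Or.inr ⟨hxy, hy⟩, Or.inl rfl⟩
  intro f hf
  rw [mem_neighborFinset] at hf
  obtain ⟨hne, -, hfG, x, hx, y, hy, hxy⟩ := hf
  obtain ⟨q, rfl⟩ := Sym2.mem_iff_exists.1 hy
  have hyq : G.Adj y q := hfG
  obtain ⟨z, hz, hz'⟩ := key x hx y q hyq hne hxy
  have hinc : s(y, q) ∈ G.incidenceFinset z := by
    rw [mem_incidenceFinset]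
    exact ⟨hyq, Sym2.mem_iff.2 hz'⟩
  rw [Finset.mem_union, Finset.mem_biUnion, Finset.mem_biUnion]
  rcases hz with hz | hz
  · exact Or.inl ⟨z, by simp [hz], hinc⟩
  · exact Or.inr ⟨z, by simp [hz], hinc⟩

lemma card_biUnion_incidenceFinset_add_le {u v : V} (h : G.Adj u v) :
    (((G.neighborFinset u).erase v).biUnion (fun x => G.incidenceFinset x)).card + G.degree v ≤
      G.nbrDegreeSum u := by
  have h1 : (((G.neighborFinset u).erase v).biUnion (fun x => G.incidenceFinset x)).card ≤
      ∑ x ∈ (G.neighborFinset u).erase v, G.degree x :=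
    Finset.card_biUnion_le.trans
      (Finset.sum_le_sum fun x _ => (G.card_incidenceFinset_eq_degree x).le)
  have h2 := Finset.sum_erase_add (G.neighborFinset u) (fun x => G.degree x)
    (show v ∈ G.neighborFinset u by simpa using h)
  unfold nbrDegreeSum
  omega

/-- An edge `uv` sees only edges incident with a neighbor of `u` other than `v` or with a neighbor
of `v` other than `u`. -/
lemma degree_conflictGraph_add_le {u v : V} (h : G.Adj u v) :
    G.conflictGraph.degree s(u, v) + G.degree u + G.degree v ≤
      G.nbrDegreeSum u + G.nbrDegreeSum v := by
  have h1 := Finset.card_le_card (conflictGraph_neighborFinset_subset h)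
  rw [card_neighborFinset_eq_degree] at h1
  have h2 := h1.trans (Finset.card_union_le _ _)
  have h3 := card_biUnion_incidenceFinset_add_le h
  have h4 := card_biUnion_incidenceFinset_add_le h.symm
  omega

/-- In a cycle `u v y x` of length four, the edge `xy` is counted twice in the bound
`degree_conflictGraph_add_le` for `uv`. -/
lemma degree_conflictGraph_add_lt {u v x y : V} (h : G.Adj u v) (hux : G.Adj u x)
    (hvy : G.Adj v y) (hxy : G.Adj x y) (hxv : x ≠ v) (hyu : y ≠ u) :
    G.conflictGraph.degree s(u, v) + G.degree u + G.degree v <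
      G.nbrDegreeSum u + G.nbrDegreeSum v := by
  have h1 := Finset.card_le_card (conflictGraph_neighborFinset_subset h)
  rw [card_neighborFinset_eq_degree] at h1
  have h2 := Finset.card_union_add_card_inter
    (((G.neighborFinset u).erase v).biUnion (fun x => G.incidenceFinset x))
    (((G.neighborFinset v).erase u).biUnion (fun x => G.incidenceFinset x))
  have h3 := card_biUnion_incidenceFinset_add_le h
  have h4 := card_biUnion_incidenceFinset_add_le h.symm
  have h5 : 0 < ((((G.neighborFinset u).erase v).biUnion (fun x => G.incidenceFinset x)) ∩
    (((G.neighborFinset v).erase u).biUnion (fun x => G.incidenceFinset x))).card := by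
    refine Finset.card_pos.2 ⟨s(x, y), ?_⟩
    rw [Finset.mem_inter, Finset.mem_biUnion, Finset.mem_biUnion]
    refine ⟨⟨x, by simp [hxv, hux], ?_⟩, ⟨y, by simp [hyu, hvy], ?_⟩⟩ <;>
    · rw [mem_incidenceFinset]
      exact ⟨hxy, by simp⟩
  omega

lemma mem_incidenceFinset_iff_exists {v : V} {e : Sym2 V} :
    e ∈ G.incidenceFinset v ↔ ∃ u, G.Adj v u ∧ e = s(v, u) := by
  rw [mem_incidenceFinset]
  constructor
  · rintro ⟨he, hv⟩
    obtain ⟨u, rfl⟩ := Sym2.mem_iff_exists.1 hv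
    exact ⟨u, he, rfl⟩
  · rintro ⟨u, hu, rfl⟩
    exact ⟨hu, by simp⟩

lemma card_neighborFinset_sdiff_add_le {E : Type*} [Fintype E] [DecidableEq E]
    {H : SimpleGraph E} {e : E}
    {S F : Finset E} (h : ∀ s ∈ S, H.Adj e s ∧ s ∈ F) :
    (H.neighborFinset e \ F).card + S.card ≤ H.degree e := by
  rw [← Finset.card_union_of_disjoint, ← card_neighborFinset_eq_degree]
  · refine Finset.card_le_card (Finset.union_subset Finset.sdiff_subset fun s hs => ?_)
    simpa using (h s hs).1
  · exact Finset.disjoint_left.2 fun s hs hsS => (Finset.mem_sdiff.1 hs).2 (h s hsS).2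

lemma degree_lt_card_neighborFinset_sdiff_add {E : Type*} [Fintype E] [DecidableEq E]
    {H : SimpleGraph E} {e : E}
    {F : Finset E} (h : e ∈ F) :
    H.degree e < (H.neighborFinset e \ F).card + F.card := by
  have h1 := Finset.card_le_card_sdiff_add_card (s := H.neighborFinset e) (t := F.erase e)
  have h2 : H.neighborFinset e \ F.erase e = H.neighborFinset e \ F := by
    ext f
    simp only [Finset.mem_sdiff, mem_neighborFinset, Finset.mem_erase, not_and]
    exact ⟨fun ⟨h, h'⟩ => ⟨h, h' h.ne'⟩, fun ⟨h, h'⟩ => ⟨h, fun _ => h'⟩⟩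
  rw [h2, Finset.card_erase_of_mem h, card_neighborFinset_eq_degree] at h1
  have := Finset.card_pos.2 ⟨e, h⟩
  omega

lemma nbrDegreeSum_of_degree_eq_two {v u w : V} (hv : G.degree v = 2) (hu : G.Adj v u)
    (hw : G.Adj v w) (huw : u ≠ w) :
    G.nbrDegreeSum v = G.degree u + G.degree w := by
  have h : ({u, w} : Finset V) = G.neighborFinset v := by
    refine Finset.eq_of_subset_of_card_le (fun x hx => ?_) ?_
    · rw [Finset.mem_insert, Finset.mem_singleton] at hx
      rw [mem_neighborFinset]
      rcases hx with rfl | rfl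
      · exact hu
      · exact hw
    · rw [card_neighborFinset_eq_degree, hv, Finset.card_pair huw]
  rw [nbrDegreeSum, ← h, Finset.sum_pair huw]

lemma exists_adj_notMem {v : V} {S : Finset V} (hS : S.card < G.degree v) :
    ∃ w, G.Adj v w ∧ w ∉ S := by
  rw [← card_neighborFinset_eq_degree] at hS
  obtain ⟨w, hw, hwS⟩ := Finset.exists_mem_notMem_of_card_lt_card hS
  exact ⟨w, by simpa using hw, hwS⟩

lemma degree_pos_of_adj {u v : V} (h : G.Adj u v) : 0 < G.degree u :=
  (G.degree_pos_iff_exists_adj u).2 ⟨v, h⟩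

/-- The number of neighbors of `v` of degree `4`. -/
noncomputable def fourCount (G : SimpleGraph V) (v : V) : ℕ :=
  ((G.neighborFinset v).filter fun x => G.degree x = 4).card

/-! ### Reducible configurations -/

/-- The properties of a smallest graph of Ore-degree at most `7` without a strong edge-coloring with
`13` colors that are used below: a coloring of `G - v` does not extend to the edges at `v`. -/
structure IsCritical (G : SimpleGraph V) : Prop where
  ore : ∀ u v, G.Adj u v → G.degree u + G.degree v ≤ 7
  not_extendable : ∀ v, 0 < G.degree v →
    ¬ G.conflictGraph.Extendable (Fin 13) (G.incidenceFinset v)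

namespace IsCritical

/-- Otherwise the edges at `v` could be colored greedily, one that sees fewer than `13` edges last. -/
lemma degree_conflictGraph_eq (hG : G.IsCritical) {v : V}
    (h : ∀ u, G.Adj v u → G.conflictGraph.degree s(v, u) ≤ 13) {u : V} (hu : G.Adj v u) :
    G.conflictGraph.degree s(v, u) = 13 := by
  refine le_antisymm (h u hu) (not_lt.1 fun hlt => ?_)
  refine hG.not_extendable v (degree_pos_of_adj hu) ?_
  refine (extendable_insert_of_apex (p := s(v, u)) (R := (G.incidenceFinset v).erase s(v, u))
    (by simpa using hlt) fun r hr => ?_).mono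
    (Finset.insert_erase (mem_incidenceFinset_iff_exists.2 ⟨u, hu, rfl⟩)).ge
  obtain ⟨hne, hr⟩ := Finset.mem_erase.1 hr
  obtain ⟨w, hw, rfl⟩ := mem_incidenceFinset_iff_exists.1 hr
  exact ⟨conflictGraph_adj_of_star hu hw fun h => hne (by rw [h]), by simpa using h w hw⟩

/-- By the bound on the Ore-degree, the neighbors of `u` outside `S` have degree at most
`7 - d(u)`. -/
lemma nbrDegreeSum_le (hG : G.IsCritical) {u : V} {S : Finset V}
    (hS : ∀ r ∈ S, G.Adj u r ∧ G.degree r = 2) :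
    G.nbrDegreeSum u ≤ 2 * S.card + (G.degree u - S.card) * (7 - G.degree u) := by
  have hsub : S ⊆ G.neighborFinset u := fun r hr => by simpa using (hS r hr).1
  rw [nbrDegreeSum, ← Finset.sum_sdiff hsub, add_comm]
  refine add_le_add ?_ ?_
  · rw [Finset.sum_congr rfl fun r hr => (hS r hr).2, Finset.sum_const, smul_eq_mul, mul_comm]
  · rw [← card_neighborFinset_eq_degree, ← Finset.card_sdiff_of_subset hsub,
      card_neighborFinset_eq_degree]
    refine (Finset.sum_le_card_nsmul _ _ (7 - G.degree u) fun x hx => ?_).trans_eq (smul_eq_mul _ _)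
    have := hG.ore u x (by simpa using (Finset.mem_sdiff.1 hx).1)
    omega

lemma two_le_degree (hG : G.IsCritical) {v : V} (hv : 0 < G.degree v) : 2 ≤ G.degree v := by
  by_contra hlt
  have h1 : G.degree v = 1 := by omega
  obtain ⟨u, hu⟩ := (G.degree_pos_iff_exists_adj v).1 hv
  have hN : G.neighborFinset v = {u} := by
    refine (Finset.eq_of_subset_of_card_le (by simpa using hu) ?_).symm
    rw [card_neighborFinset_eq_degree, h1, Finset.card_singleton]
  have hDv : G.nbrDegreeSum v = G.degree u := by rw [nbrDegreeSum, hN, Finset.sum_singleton]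
  have hDu := hG.nbrDegreeSum_le (u := u) (S := ∅) (by simp)
  have hdeg := degree_conflictGraph_add_le hu
  have hore := hG.ore v u hu
  have hle : G.conflictGraph.degree s(v, u) ≤ 12 := by
    have h6 : G.degree u ≤ 6 := by omega
    rw [hDv, h1] at hdeg
    generalize G.degree u = d at *
    simp only [Finset.card_empty, mul_zero, zero_add, Nat.sub_zero] at hDu
    interval_cases d <;> omega
  have := hG.degree_conflictGraph_eq (v := v) (fun w hw => ?_) hu
  · omega
  · have : w ∈ G.neighborFinset v := by simpa using hw
    rw [hN, Finset.mem_singleton] at this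
    rw [this]
    omega

lemma degree_le_five (hG : G.IsCritical) (v : V) : G.degree v ≤ 5 := by
  by_contra hlt
  obtain ⟨u, hu⟩ := (G.degree_pos_iff_exists_adj v).1 (by omega)
  have h1 := hG.ore v u hu
  have h2 := hG.two_le_degree (degree_pos_of_adj hu.symm)
  omega

lemma nbrDegreeSum_le_of_adj_two (hG : G.IsCritical) {u r : V} (hur : G.Adj u r)
    (hr : G.degree r = 2) : G.nbrDegreeSum u ≤ 11 ∧ (G.degree u ≠ 4 → G.nbrDegreeSum u ≤ 10) := by
  have h1 := hG.nbrDegreeSum_le (u := u) (S := {r}) (by simp [hur, hr])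
  have h2 := hG.degree_le_five u
  have h3 := hG.two_le_degree (degree_pos_of_adj hur)
  rw [Finset.card_singleton] at h1
  generalize G.degree u = d at *
  interval_cases d <;> omega

/-- If `u` had degree at most `3`, then with the other neighbor `w` of `r` the edge `rw` would see at most
`12` edges and `ru` at most `13`. -/
lemma four_le_degree_of_adj_two (hG : G.IsCritical) {r u : V} (hr : G.degree r = 2)
    (hru : G.Adj r u) : 4 ≤ G.degree u := by
  by_contra hlt
  obtain ⟨w, hw, hwu⟩ := exists_adj_notMem (G := G) (v := r) (S := {u}) (by simp [hr])
  rw [Finset.mem_singleton] at hwu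
  have hD := nbrDegreeSum_of_degree_eq_two hr hru hw (Ne.symm hwu)
  have hu := (hG.nbrDegreeSum_le_of_adj_two hru.symm hr).2 (by omega)
  have hw' := (hG.nbrDegreeSum_le_of_adj_two hw.symm hr).1
  have h1 := degree_conflictGraph_add_le hru
  have h2 := degree_conflictGraph_add_le hw
  have h5 := hG.degree_le_five w
  have := hG.degree_conflictGraph_eq (v := r) (fun x hx => ?_) hw
  · omega
  · by_cases hxu : x = u
    · subst hxu
      omega
    · have hN := nbrDegreeSum_of_degree_eq_two hr hru hx (Ne.symm hxu)
      have hx' := (hG.nbrDegreeSum_le_of_adj_two hx.symm hr).1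
      have h3 := degree_conflictGraph_add_le hx
      omega

lemma eq_of_adj_two_of_degree_eq_two {r u w x : V} (hr : G.degree r = 2) (hu : G.Adj r u)
    (hw : G.Adj r w) (huw : u ≠ w) (hx : G.Adj r x) : x = u ∨ x = w := by
  by_contra h
  rw [not_or] at h
  have h3 : ({x, u, w} : Finset V) ⊆ G.neighborFinset r := by
    intro y hy
    simp only [Finset.mem_insert, Finset.mem_singleton] at hy
    rw [mem_neighborFinset]
    rcases hy with rfl | rfl | rfl <;> assumption
  have := Finset.card_le_card h3
  rw [card_neighborFinset_eq_degree, Finset.card_eq_three.2 ⟨x, u, w, h.1, h.2, huw, rfl⟩] at this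
  omega

/-- A vertex of degree `4` has at most one neighbor of degree `2`: with a second one, the two edges at
`r` would see at most `13` edges each, and one of them at most `12`. -/
lemma eq_of_four_adj_two (hG : G.IsCritical) {u r r' : V} (hu : G.degree u = 4)
    (hr : G.degree r = 2) (hr' : G.degree r' = 2) (hur : G.Adj u r) (hur' : G.Adj u r') :
    r = r' := by
  by_contra hne
  have hDu := hG.nbrDegreeSum_le (u := u) (S := {r, r'}) (by simp [hur, hur', hr, hr'])
  rw [Finset.card_pair hne, hu] at hDu
  obtain ⟨w, hw, hwu⟩ := exists_adj_notMem (G := G) (v := r) (S := {u}) (by simp [hr])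
  rw [Finset.mem_singleton] at hwu
  have hD := nbrDegreeSum_of_degree_eq_two hr hur.symm hw (Ne.symm hwu)
  have h1 := degree_conflictGraph_add_le hur.symm
  have h2 := degree_conflictGraph_add_le hw
  have h5 := hG.degree_le_five w
  have hDw := hG.nbrDegreeSum_le_of_adj_two hw.symm hr
  have hall : ∀ x, G.Adj r x → G.conflictGraph.degree s(r, x) ≤ 13 := by
    intro x hx
    rcases eq_of_adj_two_of_degree_eq_two hr hur.symm hw (Ne.symm hwu) hx with rfl | rfl <;> omega
  have h3 := hG.degree_conflictGraph_eq hall hur.symm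
  have h4 := hG.degree_conflictGraph_eq hall hw
  omega

/-- If `u` has degree `5`, then the edges at `u` see exactly `13` edges each, so that all vertices at
distance two from `u` have degree `5`, and the edges to them see at most `13` edges. With the edges at
`u`, two edges `v₁w₁` and `v₂w₂` that continue two of them form a complete graph minus one
edge in the conflict graph. -/
lemma degree_le_four (hG : G.IsCritical) (u : V) : G.degree u ≤ 4 := by
  by_contra hlt
  have hu : G.degree u = 5 := le_antisymm (hG.degree_le_five u) (by omega)
  have htwo : ∀ v, G.Adj u v → G.degree v = 2 := by
    intro v hv
    have h1 := hG.ore u v hv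
    have h2 := hG.two_le_degree (degree_pos_of_adj hv.symm)
    omega
  have hDu : G.nbrDegreeSum u ≤ 10 := by
    simpa [hu] using hG.nbrDegreeSum_le (u := u) (S := ∅) (by simp)
  have hle : ∀ v, G.Adj u v → G.conflictGraph.degree s(u, v) ≤ 13 := by
    intro v hv
    obtain ⟨w, hw, hwu⟩ := exists_adj_notMem (G := G) (v := v) (S := {u}) (by simp [htwo v hv])
    rw [Finset.mem_singleton] at hwu
    have hD := nbrDegreeSum_of_degree_eq_two (htwo v hv) hv.symm hw (Ne.symm hwu)
    have h1 := degree_conflictGraph_add_le hv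
    have h2 := hG.degree_le_five w
    have h3 := htwo v hv
    omega
  have heq : ∀ v, G.Adj u v → G.conflictGraph.degree s(u, v) = 13 :=
    fun v hv => hG.degree_conflictGraph_eq hle hv
  have hnext : ∀ v, G.Adj u v → ∃ w, G.Adj v w ∧ w ≠ u ∧ G.degree w = 5 ∧
      G.conflictGraph.degree s(v, w) ≤ 13 := by
    intro v hv
    obtain ⟨w, hw, hwu⟩ := exists_adj_notMem (G := G) (v := v) (S := {u}) (by simp [htwo v hv])
    rw [Finset.mem_singleton] at hwu
    have hD := nbrDegreeSum_of_degree_eq_two (htwo v hv) hv.symm hw (Ne.symm hwu)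
    have h1 := degree_conflictGraph_add_le hv
    have h2 := hG.degree_le_five w
    have h3 := htwo v hv
    have h4 := heq v hv
    have h5 : G.degree w = 5 := by omega
    have h6 := (hG.nbrDegreeSum_le_of_adj_two hw.symm h3).2 (by omega)
    have h7 := degree_conflictGraph_add_le hw
    exact ⟨w, hw, hwu, h5, by omega⟩
  obtain ⟨v₁, hv₁⟩ := (G.degree_pos_iff_exists_adj u).1 (by omega)
  obtain ⟨v₂, hv₂, hv⟩ := exists_adj_notMem (G := G) (v := u) (S := {v₁}) (by simp [hu])
  rw [Finset.mem_singleton] at hv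
  obtain ⟨w₁, hw₁, hwu₁, hdw₁, hc₁⟩ := hnext v₁ hv₁
  obtain ⟨w₂, hw₂, hwu₂, hdw₂, hc₂⟩ := hnext v₂ hv₂
  have hd₁ := htwo v₁ hv₁
  have hd₂ := htwo v₂ hv₂
  have hww : w₁ ≠ w₂ := by
    rintro rfl
    have h1 := degree_conflictGraph_add_lt hv₁ hv₂ hw₁ hw₂ hv hwu₁
    have h2 := nbrDegreeSum_of_degree_eq_two hd₁ hv₁.symm hw₁ hwu₁.symm
    have h3 := heq v₁ hv₁
    omega
  have hsees : ∀ v w, G.Adj u v → G.Adj v w → w ≠ u → ∀ e ∈ G.incidenceFinset u,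
      G.conflictGraph.Adj s(v, w) e := by
    intro v w hv hw hwu e he
    obtain ⟨x, hx, rfl⟩ := mem_incidenceFinset_iff_exists.1 he
    by_cases hxv : x = v
    · subst hxv
      rw [Sym2.eq_swap (a := u)]
      exact conflictGraph_adj_of_star hw hv.symm hwu
    · rw [Sym2.eq_swap (a := v)]
      exact conflictGraph_adj_of_path hw.symm hv.symm hx hwu
  have hp : s(u, v₁) ∈ G.incidenceFinset u := mem_incidenceFinset_iff_exists.2 ⟨v₁, hv₁, rfl⟩
  have hnotMem : ∀ v w, G.Adj u v → w ≠ u → s(v, w) ∉ G.incidenceFinset u := by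
    intro v w hv hwu h
    rw [mem_incidenceFinset] at h
    rcases Sym2.mem_iff.1 h.2 with h | h
    · exact hv.ne h
    · exact hwu h.symm
  have hsave : G.conflictGraph.ExtendableSaving (Fin 13) s(u, v₁) (G.incidenceFinset u) := by
    rw [← Finset.insert_erase hp]
    refine extendableSaving_insert_of_apex (by simpa using hle v₁ hv₁) fun r hr => ?_
    obtain ⟨hne, hr⟩ := Finset.mem_erase.1 hr
    obtain ⟨w, hw, rfl⟩ := mem_incidenceFinset_iff_exists.1 hr
    exact ⟨conflictGraph_adj_of_star hv₁ hw fun h => hne (by rw [h]), by simpa using hle w hw⟩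
  set F : Finset (Sym2 V) := insert s(v₁, w₁) (insert s(v₂, w₂) (G.incidenceFinset u)) with hF
  have hcardU : (G.incidenceFinset u).card = 5 := by rw [card_incidenceFinset_eq_degree, hu]
  have ha := card_neighborFinset_sdiff_add_le (H := G.conflictGraph) (e := s(v₁, w₁)) (F := F)
    (S := G.incidenceFinset u) fun e he => ⟨hsees v₁ w₁ hv₁ hw₁ hwu₁ e he, by simp [hF, he]⟩
  have hb := card_neighborFinset_sdiff_add_le (H := G.conflictGraph) (e := s(v₂, w₂)) (F := F)
    (S := G.incidenceFinset u) fun e he => ⟨hsees v₂ w₂ hv₂ hw₂ hwu₂ e he, by simp [hF, he]⟩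
  have hpF := degree_lt_card_neighborFinset_sdiff_add (H := G.conflictGraph) (e := s(u, v₁))
    (F := F) (by simp [hF, hp])
  have hcardF : F.card ≤ 7 := by
    rw [hF]
    exact (Finset.card_insert_le _ _).trans (Nat.add_le_add_right
      ((Finset.card_insert_le _ _).trans (Nat.add_le_add_right hcardU.le 1)) 1)
  have h13 := heq v₁ hv₁
  refine hG.not_extendable u (by omega) (Extendable.mono (hsave.extendable (a := s(v₁, w₁))
    (b := s(v₂, w₂)) hF (hnotMem _ _ hv₁ hwu₁) (hnotMem _ _ hv₂ hwu₂) ?_ ?_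
    (hsees _ _ hv₁ hw₁ hwu₁ _ hp).symm (hsees _ _ hv₂ hw₂ hwu₂ _ hp).symm ?_ ?_ ?_) ?_)
  · intro h
    have : v₁ ∈ s(v₂, w₂) := h ▸ by simp
    rcases Sym2.mem_iff.1 this with h | h
    · exact hv h.symm
    · subst h; omega
  · rintro ⟨-, -, -, x, hx, y, hy, hxy⟩
    rcases Sym2.mem_iff.1 hx with rfl | rfl <;> rcases Sym2.mem_iff.1 hy with rfl | rfl <;>
      rcases hxy with hxy | hxy
    · exact hv hxy.symm
    · have := hG.four_le_degree_of_adj_two hd₁ hxy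
      omega
    · rw [hxy] at hd₁; omega
    · rcases eq_of_adj_two_of_degree_eq_two hd₁ hv₁.symm hw₁ hwu₁.symm hxy with h | h
      · exact hwu₂ h
      · exact hww h.symm
    · rw [hxy] at hdw₁; omega
    · rcases eq_of_adj_two_of_degree_eq_two hd₂ hv₂.symm hw₂ hwu₂.symm hxy.symm with h | h
      · exact hwu₁ h
      · exact hww h
    · exact hww hxy
    · have := hG.ore _ _ hxy
      omega
  · rw [Fintype.card_fin]; omega
  · rw [Fintype.card_fin]; omega
  · rw [Fintype.card_fin]; omega
  · rw [hF]
    exact (Finset.subset_insert _ _).trans (Finset.subset_insert _ _)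

lemma degree_eq_of_adj_two (hG : G.IsCritical) {r u : V} (hr : G.degree r = 2)
    (hru : G.Adj r u) : G.degree u = 4 :=
  le_antisymm (hG.degree_le_four u) (hG.four_le_degree_of_adj_two hr hru)

lemma degree_of_adj_three (hG : G.IsCritical) {v u : V} (hv : G.degree v = 3)
    (hvu : G.Adj v u) : G.degree u = 3 ∨ G.degree u = 4 := by
  have h1 := hG.two_le_degree (degree_pos_of_adj hvu.symm)
  have h2 := hG.degree_le_four u
  have h3 : G.degree u ≠ 2 := fun h => by
    have := hG.degree_eq_of_adj_two h hvu.symm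
    omega
  omega

lemma nbrDegreeSum_le_of_degree_eq_three (hG : G.IsCritical) {v : V} (hv : G.degree v = 3) :
    G.nbrDegreeSum v ≤ 9 + G.fourCount v := by
  have h1 : G.nbrDegreeSum v ≤
      ∑ x ∈ G.neighborFinset v, (3 + if G.degree x = 4 then 1 else 0) := by
    refine Finset.sum_le_sum fun x hx => ?_
    rcases hG.degree_of_adj_three hv (by simpa using hx) with h | h <;> simp [h]
  rw [Finset.sum_add_distrib, Finset.sum_const, card_neighborFinset_eq_degree, hv,
    Finset.sum_boole] at h1
  simpa [fourCount] using h1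

lemma fourCount_eq_zero_iff {v : V} : G.fourCount v = 0 ↔ ∀ u, G.Adj v u → G.degree u ≠ 4 := by
  simp [fourCount, Finset.filter_eq_empty_iff]

lemma degree_conflictGraph_le_of_fourCount_eq_zero (hG : G.IsCritical) {v u : V}
    (hv : G.degree v = 3) (hv0 : G.fourCount v = 0) (hvu : G.Adj v u) :
    G.degree u = 3 ∧ G.conflictGraph.degree s(v, u) ≤ 12 + G.fourCount u := by
  have hu : G.degree u = 3 :=
    (hG.degree_of_adj_three hv hvu).resolve_right (fourCount_eq_zero_iff.1 hv0 u hvu)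
  have h1 := hG.nbrDegreeSum_le_of_degree_eq_three hv
  have h2 := hG.nbrDegreeSum_le_of_degree_eq_three hu
  have h3 := degree_conflictGraph_add_le hvu
  exact ⟨hu, by omega⟩

lemma fourCount_le_two {v u : V} (hu : G.degree u = 3) (hvu : G.Adj u v)
    (hv : G.degree v = 3) : G.fourCount u ≤ 2 := by
  have h1 : ((G.neighborFinset u).filter fun x => G.degree x = 4) ⊆ (G.neighborFinset u).erase v := by
    intro x hx
    rw [Finset.mem_filter] at hx
    refine Finset.mem_erase.2 ⟨fun h => ?_, hx.1⟩
    rw [h] at hx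
    omega
  have h2 := Finset.card_le_card h1
  rw [Finset.card_erase_of_mem (by simpa using hvu), card_neighborFinset_eq_degree, hu] at h2
  exact h2

lemma exists_third {v u₁ u₂ : V} (hv : G.degree v = 3) (h₁ : G.Adj v u₁) (h₂ : G.Adj v u₂)
    (h₁₂ : u₁ ≠ u₂) : ∃ u₃, G.Adj v u₃ ∧ u₃ ≠ u₁ ∧ u₃ ≠ u₂ ∧
      ∀ x, G.Adj v x → x = u₁ ∨ x = u₂ ∨ x = u₃ := by
  obtain ⟨u₃, h₃, hne⟩ := exists_adj_notMem (G := G) (v := v) (S := {u₁, u₂})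
    (by rw [Finset.card_pair h₁₂, hv]; norm_num)
  simp only [Finset.mem_insert, Finset.mem_singleton, not_or] at hne
  refine ⟨u₃, h₃, hne.1, hne.2, fun x hx => ?_⟩
  have h : ({u₁, u₂, u₃} : Finset V) = G.neighborFinset v := by
    refine Finset.eq_of_subset_of_card_le (fun x hx => ?_) ?_
    · simp only [Finset.mem_insert, Finset.mem_singleton] at hx
      rw [mem_neighborFinset]
      rcases hx with rfl | rfl | rfl <;> assumption
    · rw [card_neighborFinset_eq_degree, hv,
        Finset.card_eq_three.2 ⟨u₁, u₂, u₃, h₁₂, Ne.symm hne.1, Ne.symm hne.2, rfl⟩]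
  have hx' : x ∈ G.neighborFinset v := by simpa using hx
  simpa [← h] using hx'

/-- Let all neighbors of `v` have degree `3`. If one of them has no neighbor of degree `4`, then the
two others have two each: otherwise the three edges at `v` see at most `14`, `13` and `12` edges and
can be colored in this order. -/
lemma two_le_fourCount (hG : G.IsCritical) {v u₁ u₂ : V} (hv : G.degree v = 3)
    (hv0 : G.fourCount v = 0) (h₁ : G.Adj v u₁) (h₂ : G.Adj v u₂) (h₁₂ : u₁ ≠ u₂)
    (h0 : G.fourCount u₁ = 0) : 2 ≤ G.fourCount u₂ := by
  by_contra hlt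
  obtain ⟨u₃, h₃, h₃₁, h₃₂, hall⟩ := exists_third hv h₁ h₂ h₁₂
  have hd₁ := (hG.degree_conflictGraph_le_of_fourCount_eq_zero hv hv0 h₁).2
  have hd₂ := (hG.degree_conflictGraph_le_of_fourCount_eq_zero hv hv0 h₂).2
  obtain ⟨hu₃, hd₃⟩ := hG.degree_conflictGraph_le_of_fourCount_eq_zero hv hv0 h₃
  have hf₃ := fourCount_le_two hu₃ h₃.symm hv
  have a₂₁ := conflictGraph_adj_of_star h₂ h₁ h₁₂.symm
  have a₃₁ := conflictGraph_adj_of_star h₃ h₁ h₃₁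
  have a₃₂ := conflictGraph_adj_of_star h₃ h₂ h₃₂
  have e₁ : G.conflictGraph.Extendable (Fin 13) {s(v, u₁)} := by
    have := card_neighborFinset_sdiff_add_le (H := G.conflictGraph) (e := s(v, u₁)) (S := ∅)
      (F := insert s(v, u₁) ∅) (by simp)
    exact extendable_empty.insert (by rw [Fintype.card_fin]; omega)
  have e₂ : G.conflictGraph.Extendable (Fin 13) {s(v, u₂), s(v, u₁)} := by
    have := card_neighborFinset_sdiff_add_le (H := G.conflictGraph) (e := s(v, u₂))
      (S := {s(v, u₁)}) (F := {s(v, u₂), s(v, u₁)}) (by simp [a₂₁])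
    rw [Finset.card_singleton] at this
    exact e₁.insert (by rw [Fintype.card_fin]; omega)
  have e₃ : G.conflictGraph.Extendable (Fin 13) {s(v, u₃), s(v, u₂), s(v, u₁)} := by
    have := card_neighborFinset_sdiff_add_le (H := G.conflictGraph) (e := s(v, u₃))
      (S := {s(v, u₂), s(v, u₁)}) (F := {s(v, u₃), s(v, u₂), s(v, u₁)})
      (by
        intro s hs
        rw [Finset.mem_insert, Finset.mem_singleton] at hs
        rcases hs with rfl | rfl
        · exact ⟨a₃₂, by simp⟩
        · exact ⟨a₃₁, by simp⟩)
    rw [Finset.card_pair a₂₁.ne] at this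
    exact e₂.insert (by rw [Fintype.card_fin]; omega)
  refine hG.not_extendable v (by omega) (e₃.mono fun e he => ?_)
  obtain ⟨x, hx, rfl⟩ := mem_incidenceFinset_iff_exists.1 he
  rcases hall x hx with rfl | rfl | rfl <;> simp

/-- Let all neighbors of `v` have degree `3` and at most one neighbor of degree `4`. Then the edges at
`v` see `13` edges each. If a neighbor `t` of degree `4` of a neighbor `u₁` of `v` had a neighbor `r`
of degree `2`, then `tr` would see at most `13` edges and `u₁t` at most `14`, and a coloring would extend to
the edges at `v`, `u₁t` and `tr`, because one can save a color at `vu₁` by the choice of colors for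
`tr` and `vu₂`, which do not see each other. -/
lemma two_le_fourCount_of_adj (hG : G.IsCritical) {v u₁ t r : V} (hv : G.degree v = 3)
    (hv0 : G.fourCount v = 0) (h₁ : G.Adj v u₁) (hut : G.Adj u₁ t) (ht : G.degree t = 4)
    (htr : G.Adj t r) (hr : G.degree r = 2) : ∃ u, G.Adj v u ∧ 2 ≤ G.fourCount u := by
  by_contra! hlt
  have hle : ∀ u, G.Adj v u → G.conflictGraph.degree s(v, u) ≤ 13 := by
    intro u hu
    have h1 := (hG.degree_conflictGraph_le_of_fourCount_eq_zero hv hv0 hu).2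
    have h2 := hlt u hu
    omega
  have heq : ∀ u, G.Adj v u → G.conflictGraph.degree s(v, u) = 13 :=
    fun u hu => hG.degree_conflictGraph_eq hle hu
  obtain ⟨u₂, h₂, h₂₁⟩ := exists_adj_notMem (G := G) (v := v) (S := {u₁}) (by simp [hv])
  rw [Finset.mem_singleton] at h₂₁
  obtain ⟨u₃, h₃, h₃₁, h₃₂, hall⟩ := exists_third hv h₁ h₂ (Ne.symm h₂₁)
  have hu₁ := (hG.degree_conflictGraph_le_of_fourCount_eq_zero hv hv0 h₁).1
  have hu₂ := (hG.degree_conflictGraph_le_of_fourCount_eq_zero hv hv0 h₂).1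
  have hDv := hG.nbrDegreeSum_le_of_degree_eq_three hv
  have hDu₁ := hG.nbrDegreeSum_le_of_degree_eq_three hu₁
  have hDt := (hG.nbrDegreeSum_le_of_adj_two htr hr).1
  have hf₁ := hlt u₁ h₁
  have heq₁ := heq u₁ h₁
  have hvt : t ≠ v := fun h => by rw [h] at ht; omega
  have hrv : r ≠ v := fun h => by rw [h] at hr; omega
  have hru₁ : r ≠ u₁ := fun h => by rw [h] at hr; omega
  have htu₂ : ¬ G.Adj u₂ t := by
    intro h
    have := degree_conflictGraph_add_lt h₁ h₂ hut h h₂₁ hvt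
    omega
  have hdtr : G.conflictGraph.degree s(t, r) ≤ 13 := by
    obtain ⟨w, hw, hwt⟩ := exists_adj_notMem (G := G) (v := r) (S := {t}) (by simp [hr])
    rw [Finset.mem_singleton] at hwt
    have h1 := nbrDegreeSum_of_degree_eq_two hr htr.symm hw (Ne.symm hwt)
    have h2 := hG.degree_le_four w
    have h3 := degree_conflictGraph_add_le htr
    omega
  have hdut : G.conflictGraph.degree s(u₁, t) ≤ 14 := by
    have h3 := degree_conflictGraph_add_le hut
    omega
  have apB := conflictGraph_adj_of_star h₁ h₃ h₃₁.symm
  have aAp := conflictGraph_adj_of_star h₂ h₁ h₂₁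
  have aAB := conflictGraph_adj_of_star h₂ h₃ h₃₂.symm
  have aCp : G.conflictGraph.Adj s(u₁, t) s(v, u₁) := by
    rw [Sym2.eq_swap (a := v)]
    exact conflictGraph_adj_of_star hut h₁.symm hvt
  have aCB : G.conflictGraph.Adj s(u₁, t) s(v, u₃) := by
    rw [Sym2.eq_swap (a := u₁)]
    exact conflictGraph_adj_of_path hut.symm h₁.symm h₃ hvt
  have aCA : G.conflictGraph.Adj s(u₁, t) s(v, u₂) := by
    rw [Sym2.eq_swap (a := u₁)]
    exact conflictGraph_adj_of_path hut.symm h₁.symm h₂ hvt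
  have atC : G.conflictGraph.Adj s(t, r) s(u₁, t) := by
    rw [Sym2.eq_swap (a := u₁)]
    exact conflictGraph_adj_of_star htr hut.symm hru₁
  have atp : G.conflictGraph.Adj s(t, r) s(v, u₁) := by
    rw [Sym2.eq_swap (a := t), Sym2.eq_swap (a := v)]
    exact conflictGraph_adj_of_path htr.symm hut.symm h₁.symm hru₁
  have s₁ : G.conflictGraph.ExtendableSaving (Fin 13) s(v, u₁) {s(v, u₁)} :=
    extendableSaving_singleton (by simpa using hle u₁ h₁)
  have s₂ : G.conflictGraph.ExtendableSaving (Fin 13) s(v, u₁) {s(v, u₃), s(v, u₁)} := by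
    have := card_neighborFinset_sdiff_add_le (H := G.conflictGraph) (e := s(v, u₃))
      (S := {s(v, u₁)}) (F := {s(v, u₃), s(v, u₁)}) (by simp [apB.symm])
    rw [Finset.card_singleton] at this
    have h13 := hle u₃ h₃
    exact s₁.insert (by rw [Fintype.card_fin]; omega)
  have s₃ : G.conflictGraph.ExtendableSaving (Fin 13) s(v, u₁)
      {s(u₁, t), s(v, u₃), s(v, u₁)} := by
    have := card_neighborFinset_sdiff_add_le (H := G.conflictGraph) (e := s(u₁, t))
      (S := {s(v, u₃), s(v, u₁)}) (F := {s(u₁, t), s(v, u₃), s(v, u₁)})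
      (by
        intro s hs
        rw [Finset.mem_insert, Finset.mem_singleton] at hs
        rcases hs with rfl | rfl
        · exact ⟨aCB, by simp⟩
        · exact ⟨aCp, by simp⟩)
    rw [Finset.card_pair apB.ne.symm] at this
    exact s₂.insert (by rw [Fintype.card_fin]; omega)
  set U : Finset (Sym2 V) := {s(u₁, t), s(v, u₃), s(v, u₁)} with hU
  set F : Finset (Sym2 V) := insert s(v, u₂) (insert s(t, r) U) with hF
  have hcardU : U.card = 3 :=
    Finset.card_eq_three.2 ⟨_, _, _, aCB.ne, aCp.ne, apB.ne.symm, rfl⟩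
  have ha := card_neighborFinset_sdiff_add_le (H := G.conflictGraph) (e := s(v, u₂)) (F := F)
    (S := U) (by
      intro s hs
      refine ⟨?_, by simp [hF, hs]⟩
      simp only [hU, Finset.mem_insert, Finset.mem_singleton] at hs
      rcases hs with rfl | rfl | rfl
      · exact aCA.symm
      · exact aAB
      · exact aAp)
  have hb := card_neighborFinset_sdiff_add_le (H := G.conflictGraph) (e := s(t, r)) (F := F)
    (S := {s(u₁, t), s(v, u₁)}) (by
      intro s hs
      rw [Finset.mem_insert, Finset.mem_singleton] at hs
      rcases hs with rfl | rfl
      · exact ⟨atC, by simp [hF, hU]⟩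
      · exact ⟨atp, by simp [hF, hU]⟩)
  rw [Finset.card_pair aCp.ne] at hb
  have hpF := degree_lt_card_neighborFinset_sdiff_add (H := G.conflictGraph) (e := s(v, u₁))
    (F := F) (by simp [hF, hU])
  have hcardF : F.card ≤ 5 := by
    rw [hF]
    exact (Finset.card_insert_le _ _).trans (Nat.add_le_add_right
      ((Finset.card_insert_le _ _).trans (Nat.add_le_add_right hcardU.le 1)) 1)
  have hle₂ := hle u₂ h₂
  have htv : ¬ G.Adj v t := fun h => fourCount_eq_zero_iff.1 hv0 t h ht
  have hnab : ¬ G.conflictGraph.Adj s(v, u₂) s(t, r) := by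
    rintro ⟨-, -, -, x, hx, y, hy, hxy⟩
    rcases Sym2.mem_iff.1 hx with rfl | rfl <;> rcases Sym2.mem_iff.1 hy with rfl | rfl <;>
      rcases hxy with hxy | hxy
    · exact hvt hxy.symm
    · exact htv hxy
    · exact hrv hxy.symm
    · have := hG.degree_eq_of_adj_two hr hxy.symm
      omega
    · rw [hxy] at hu₂; omega
    · exact htu₂ hxy
    · rw [hxy] at hu₂; omega
    · have := hG.degree_eq_of_adj_two hr hxy.symm
      omega
  have hAb : s(v, u₂) ≠ s(t, r) := by
    intro h
    have : v ∈ s(t, r) := h ▸ by simp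
    rcases Sym2.mem_iff.1 this with h | h
    · exact hvt h.symm
    · exact hrv h.symm
  have hAU : s(v, u₂) ∉ U := by
    simp only [hU, Finset.mem_insert, Finset.mem_singleton, not_or]
    exact ⟨aCA.ne.symm, aAB.ne, aAp.ne⟩
  have hbU : s(t, r) ∉ U := by
    simp only [hU, Finset.mem_insert, Finset.mem_singleton, not_or]
    refine ⟨atC.ne, fun h => ?_, atp.ne⟩
    have : v ∈ s(t, r) := h ▸ by simp
    rcases Sym2.mem_iff.1 this with h | h
    · exact hvt h.symm
    · exact hrv h.symm
  refine hG.not_extendable v (by omega) (Extendable.mono (s₃.extendable hF hAU hbU hAb hnab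
    aAp.symm atp.symm ?_ ?_ ?_) fun e he => ?_)
  · rw [Fintype.card_fin]; omega
  · rw [Fintype.card_fin]; omega
  · rw [Fintype.card_fin]; omega
  · obtain ⟨x, hx, rfl⟩ := mem_incidenceFinset_iff_exists.1 he
    rcases hall x hx with rfl | rfl | rfl <;> simp [hF, hU]

end IsCritical
end Finite
end Conflict

/-! ### Discharging -/

section Discharging

open scoped Classical

variable {V : Type*} [Fintype V] {G : SimpleGraph V}

/-- `v` has a neighbor of degree `2`. -/
def HasTwoNeighbor (G : SimpleGraph V) (v : V) : Prop := ∃ r, G.Adj v r ∧ G.degree r = 2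

/-- The charge that the vertex `u` sends to the vertex `v`, if a vertex of degree `d` starts with the
charge `3 (11 d - 34)`. Vertices of degree `4` give to all their neighbors. The charge is passed on
to the vertices of degree `3` without neighbors of degree `4` by their neighbors. -/
noncomputable def transfer (G : SimpleGraph V) (u v : V) : ℤ :=
  if ¬ G.Adj u v then 0
  else if G.degree u = 4 then
    if G.degree v = 2 then 18 else if G.HasTwoNeighbor u then 4 else 5
  else if G.degree u = 3 ∧ G.degree v = 3 ∧ G.fourCount v = 0 then
    if 2 ≤ G.fourCount u then 3
    else if G.fourCount u = 1 ∧ ∀ t, G.Adj u t → G.degree t = 4 → ¬ G.HasTwoNeighbor t then 1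
    else 0
  else 0

lemma transfer_nonneg (u v : V) : 0 ≤ G.transfer u v := by
  unfold transfer
  split_ifs <;> norm_num

lemma sum_transfer_to (v : V) :
    ∑ u, G.transfer u v = ∑ u ∈ G.neighborFinset v, G.transfer u v := by
  refine (Finset.sum_subset (Finset.subset_univ _) fun u _ hu => ?_).symm
  rw [mem_neighborFinset, adj_comm] at hu
  rw [transfer, if_pos hu]

lemma sum_transfer_from (v : V) :
    ∑ u, G.transfer v u = ∑ u ∈ G.neighborFinset v, G.transfer v u := by
  refine (Finset.sum_subset (Finset.subset_univ _) fun u _ hu => ?_).symm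
  rw [mem_neighborFinset] at hu
  rw [transfer, if_pos hu]

namespace IsCritical

lemma sum_transfer_of_degree_eq_two (hG : G.IsCritical) {v : V} (hv : G.degree v = 2) :
    36 + ∑ u, G.transfer v u ≤ ∑ u, G.transfer u v := by
  rw [sum_transfer_to, sum_transfer_from]
  have h1 : ∀ u ∈ G.neighborFinset v, G.transfer v u = 0 := by
    intro u _
    simp [transfer, hv]
  have h2 : ∀ u ∈ G.neighborFinset v, G.transfer u v = 18 := by
    intro u hu
    rw [mem_neighborFinset] at hu
    simp [transfer, hu.symm, hG.degree_eq_of_adj_two hv hu, hv]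
  rw [Finset.sum_congr rfl h1, Finset.sum_congr rfl h2, Finset.sum_const, Finset.sum_const,
    card_neighborFinset_eq_degree, hv]
  norm_num

lemma sum_transfer_of_degree_eq_four (hG : G.IsCritical) {v : V} (hv : G.degree v = 4) :
    ∑ u, G.transfer v u ≤ 30 := by
  rw [sum_transfer_from]
  by_cases htwo : G.HasTwoNeighbor v
  · obtain ⟨r, hvr, hr⟩ := htwo
    have hmem : r ∈ G.neighborFinset v := by simpa using hvr
    have h1 : ∀ u ∈ (G.neighborFinset v).erase r, G.transfer v u ≤ 4 := by
      intro u hu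
      obtain ⟨hur, hu⟩ := Finset.mem_erase.1 hu
      rw [mem_neighborFinset] at hu
      have hu2 : G.degree u ≠ 2 := fun h => hur (hG.eq_of_four_adj_two hv h hr hu hvr)
      have : G.HasTwoNeighbor v := ⟨r, hvr, hr⟩
      simp [transfer, hu, hv, hu2, this]
    have h2 := Finset.sum_le_card_nsmul _ (fun u => G.transfer v u) _ h1
    rw [Finset.card_erase_of_mem hmem, card_neighborFinset_eq_degree, hv] at h2
    have h3 : G.transfer v r = 18 := by simp [transfer, hvr, hv, hr]
    rw [← Finset.sum_erase_add _ _ hmem, h3]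
    norm_num at h2 ⊢
    omega
  · have h1 : ∀ u ∈ G.neighborFinset v, G.transfer v u ≤ 5 := by
      intro u hu
      rw [mem_neighborFinset] at hu
      have hu2 : G.degree u ≠ 2 := fun h => htwo ⟨u, hu, h⟩
      simp [transfer, hu, hv, hu2, htwo]
    have h2 := Finset.sum_le_card_nsmul _ (fun u => G.transfer v u) _ h1
    rw [card_neighborFinset_eq_degree, hv] at h2
    norm_num at h2
    omega

lemma sum_transfer_of_degree_eq_three (hG : G.IsCritical) {v : V} (hv : G.degree v = 3) :
    3 + ∑ u, G.transfer v u ≤ ∑ u, G.transfer u v := by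
  rw [sum_transfer_to, sum_transfer_from]
  by_cases hv0 : G.fourCount v = 0
  · have h1 : ∀ u ∈ G.neighborFinset v, G.transfer v u = 0 := by
      intro u _
      simp [transfer, hv, hv0]
    rw [Finset.sum_congr rfl h1, Finset.sum_const_zero, add_zero]
    by_cases h2 : ∃ u, G.Adj v u ∧ 2 ≤ G.fourCount u
    · obtain ⟨u, hu, hu2⟩ := h2
      have hu3 := (hG.degree_conflictGraph_le_of_fourCount_eq_zero hv hv0 hu).1
      have h3 : G.transfer u v = 3 := by simp [transfer, hu.symm, hv, hv0, hu3, hu2]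
      rw [← h3]
      exact Finset.single_le_sum (f := fun u => G.transfer u v) (fun x _ => transfer_nonneg x v)
        (by simpa using hu)
    · have h3 : ∀ u ∈ G.neighborFinset v, G.transfer u v = 1 := by
        intro u hu
        rw [mem_neighborFinset] at hu
        have hu3 := (hG.degree_conflictGraph_le_of_fourCount_eq_zero hv hv0 hu).1
        have hlt : ¬ 2 ≤ G.fourCount u := fun h => h2 ⟨u, hu, h⟩
        have hne : G.fourCount u ≠ 0 := by
          intro h0
          obtain ⟨w, hw, hwu⟩ := exists_adj_notMem (G := G) (v := v) (S := {u}) (by simp [hv])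
          rw [Finset.mem_singleton] at hwu
          exact h2 ⟨w, hw, hG.two_le_fourCount hv hv0 hu hw (Ne.symm hwu) h0⟩
        have hone : G.fourCount u = 1 := by omega
        have hgood : ∀ t, G.Adj u t → G.degree t = 4 → ¬ G.HasTwoNeighbor t :=
          fun t hut ht ⟨r, htr, hr⟩ => h2 (hG.two_le_fourCount_of_adj hv hv0 hu hut ht htr hr)
        rw [transfer, if_neg (not_not.2 hu.symm), if_neg (by omega), if_pos ⟨hu3, hv, hv0⟩,
          if_neg hlt, if_pos ⟨hone, hgood⟩]
      rw [Finset.sum_congr rfl h3, Finset.sum_const, card_neighborFinset_eq_degree, hv]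
      norm_num
  · -- `m` bounds what `v` receives from a neighbor of degree `4` from below, and `M` what it sends
    -- to a neighbor of degree `3` from above
    have key : ∀ m M : ℤ,
        (∀ u, G.Adj v u → G.degree u = 4 → m ≤ G.transfer u v) →
        (∀ u, G.Adj v u → G.degree u ≠ 4 → G.transfer v u ≤ M) →
        3 + (3 - G.fourCount v) * M ≤ G.fourCount v * m →
        3 + ∑ u ∈ G.neighborFinset v, G.transfer v u ≤
          ∑ u ∈ G.neighborFinset v, G.transfer u v := by
      intro m M hm hM hmM
      have hin : (G.fourCount v : ℤ) * m ≤ ∑ u ∈ G.neighborFinset v, G.transfer u v := by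
        refine le_trans ?_ (Finset.sum_le_sum_of_subset_of_nonneg
          (Finset.filter_subset (fun x => G.degree x = 4) _) fun u _ _ => transfer_nonneg u v)
        rw [fourCount, ← nsmul_eq_mul]
        refine Finset.card_nsmul_le_sum _ _ _ fun u hu => ?_
        rw [Finset.mem_filter, mem_neighborFinset] at hu
        exact hm u hu.1 hu.2
      have hout : ∑ u ∈ G.neighborFinset v, G.transfer v u ≤ (3 - G.fourCount v : ℤ) * M := by
        rw [← Finset.sum_filter_add_sum_filter_not _ (fun x => G.degree x = 4)]
        have h4 : ∀ u ∈ (G.neighborFinset v).filter (fun x => G.degree x = 4),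
            G.transfer v u = 0 := by
          intro u hu
          simp [transfer, hv, (Finset.mem_filter.1 hu).2]
        have h3 := Finset.sum_le_card_nsmul
          ((G.neighborFinset v).filter fun x => ¬ G.degree x = 4) (fun u => G.transfer v u) M
          fun u hu => by
            rw [Finset.mem_filter, mem_neighborFinset] at hu
            exact hM u hu.1 hu.2
        have hcard := Finset.card_filter_add_card_filter_not (s := G.neighborFinset v)
          (fun x => G.degree x = 4)
        rw [card_neighborFinset_eq_degree, hv] at hcard
        have hcard' : ((((G.neighborFinset v).filter fun x => ¬ G.degree x = 4).card : ℕ) : ℤ) =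
            3 - G.fourCount v := by
          unfold fourCount
          omega
        rw [nsmul_eq_mul, hcard'] at h3
        rw [Finset.sum_congr rfl h4, Finset.sum_const_zero, zero_add]
        exact h3
      linarith
    have hfour : ∀ u, G.Adj v u → G.degree u = 4 → 4 ≤ G.transfer u v := by
      intro u hu hu4
      rw [transfer, if_neg (not_not.2 hu.symm), if_pos hu4, if_neg (by omega)]
      split_ifs <;> norm_num
    have hle3 : G.fourCount v ≤ 3 := by
      rw [← hv, ← card_neighborFinset_eq_degree]
      exact Finset.card_filter_le _ _
    by_cases h2 : 2 ≤ G.fourCount v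
    · refine key 4 3 hfour (fun u _ _ => ?_) (by omega)
      unfold transfer
      split_ifs <;> omega
    · have h1 : G.fourCount v = 1 := by omega
      by_cases hgood : ∀ t, G.Adj v t → G.degree t = 4 → ¬ G.HasTwoNeighbor t
      · refine key 5 1 (fun u hu hu4 => ?_) (fun u _ _ => ?_) (by rw [h1]; norm_num)
        · rw [transfer, if_neg (not_not.2 hu.symm), if_pos hu4, if_neg (by omega),
            if_neg (hgood u hu hu4)]
        · unfold transfer
          split_ifs <;> omega
      · refine key 4 0 hfour (fun u _ _ => ?_) (by rw [h1]; norm_num)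
        unfold transfer
        split_ifs <;> first | omega | exact absurd (And.right ‹_›) hgood

/-- The vertices of positive degree of a critical graph have average degree at least `34 / 11`. -/
theorem card_le_sum_degree (hG : G.IsCritical) :
    34 * (Finset.univ.filter fun v => 0 < G.degree v).card ≤ 11 * ∑ v, G.degree v := by
  have hfinal : ∀ v, 0 ≤ (if 0 < G.degree v then 33 * (G.degree v : ℤ) - 102 else 0) +
      ∑ u, G.transfer u v - ∑ u, G.transfer v u := by
    intro v
    by_cases hv : 0 < G.degree v
    · rw [if_pos hv]
      have h2 := hG.two_le_degree hv
      have h4 := hG.degree_le_four v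
      have hcases : G.degree v = 2 ∨ G.degree v = 3 ∨ G.degree v = 4 := by omega
      rcases hcases with h | h | h
      · have := hG.sum_transfer_of_degree_eq_two h
        rw [h]
        push_cast
        linarith
      · have := hG.sum_transfer_of_degree_eq_three h
        rw [h]
        push_cast
        linarith
      · have := hG.sum_transfer_of_degree_eq_four h
        have h0 : 0 ≤ ∑ u, G.transfer u v := Finset.sum_nonneg fun u _ => transfer_nonneg u v
        rw [h]
        push_cast
        linarith
    · have h0 : G.neighborFinset v = ∅ := by
        rw [← Finset.card_eq_zero, card_neighborFinset_eq_degree]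
        omega
      rw [if_neg hv, sum_transfer_to, sum_transfer_from, h0]
      simp
  have hsum := Finset.sum_nonneg fun v (_ : v ∈ Finset.univ) => hfinal v
  rw [Finset.sum_sub_distrib, Finset.sum_add_distrib,
    Finset.sum_comm (f := fun v u => G.transfer u v), add_sub_cancel_right,
    ← Finset.sum_filter, Finset.sum_sub_distrib, ← Finset.mul_sum, Finset.sum_const,
    nsmul_eq_mul] at hsum
  have hdeg : ∑ v ∈ Finset.univ.filter (fun v => 0 < G.degree v), (G.degree v : ℤ) =
      ∑ v, (G.degree v : ℤ) := by
    refine Finset.sum_subset (Finset.subset_univ _) fun v _ hv => ?_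
    simp only [Finset.mem_filter, Finset.mem_univ, true_and, not_lt, Nat.le_zero] at hv
    simp [hv]
  rw [hdeg] at hsum
  have : (34 : ℤ) * (Finset.univ.filter fun v => 0 < G.degree v).card ≤
      11 * ∑ v, (G.degree v : ℤ) := by linarith
  exact_mod_cast this

end IsCritical
end Discharging

/-! ### The strong chromatic index -/

section Main

variable {V : Type*} {G : SimpleGraph V}

lemma conflictGraph_adj_of_seesGraph_adj {e f : G.edgeSet} (h : G.seesGraph.Adj e f) :
    G.conflictGraph.Adj e f := by
  have hne : (e : Sym2 V) ≠ f := Subtype.coe_injective.ne h.ne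
  rcases h with h | h
  · rw [dist_eq_one_iff_adj, lineGraph_adj_iff_exists] at h
    obtain ⟨-, x, hx, hx'⟩ := h
    exact ⟨hne, e.2, f.2, x, hx, x, hx', Or.inl rfl⟩
  · obtain ⟨p, hp⟩ := exists_walk_of_dist_ne_zero (G := G.lineGraph) (u := e) (v := f) (by omega)
    rw [h] at hp
    match p, hp with
    | .cons (v := g) h₁ (.cons h₂ .nil), _ =>
      rw [lineGraph_adj_iff_exists] at h₁ h₂
      obtain ⟨-, x, hx, hx'⟩ := h₁
      obtain ⟨-, y, hy, hy'⟩ := h₂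
      refine ⟨hne, e.2, f.2, x, hx, y, hy', ?_⟩
      by_cases hxy : x = y
      · exact Or.inl hxy
      · refine Or.inr ?_
        have hg : (g : Sym2 V) = s(x, y) := (Sym2.mem_and_mem_iff hxy).1 ⟨hx', hy⟩
        have := g.2
        rwa [hg] at this

lemma strongChromaticIndex_le {k : ℕ} (h : Nonempty (G.conflictGraph.Coloring (Fin k))) :
    G.strongChromaticIndex ≤ k := by
  obtain ⟨c⟩ := h
  exact iInf₂_le (f := fun (k : ℕ) (_ : k ∈ {k : ℕ | Nonempty (G.StrongEdgeColoring k)}) => (k : ℕ∞))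
    k ⟨Coloring.mk (fun e => c e) fun h => c.valid (conflictGraph_adj_of_seesGraph_adj h)⟩

open scoped Classical

variable [Fintype V]

/-- A coloring of `G - v` is a proper coloring of the conflict graph of `G` outside the edges at `v`,
since an edge that joins two edges of `G - v` lies in `G - v` as well. -/
lemma properOff_of_deleteIncidenceSet {α : Type*} (v : V)
    (c : (G.deleteIncidenceSet v).conflictGraph.Coloring α) :
    G.conflictGraph.ProperOff (G.incidenceFinset v) c := by
  rintro e f he hf ⟨hne, heG, hfG, x, hx, y, hy, hxy⟩
  rw [mem_incidenceFinset] at he hf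
  refine c.valid ⟨hne, ?_, ?_, x, hx, y, hy, hxy.imp id fun hxy => ?_⟩
  · rw [edgeSet_deleteIncidenceSet]
    exact ⟨heG, he⟩
  · rw [edgeSet_deleteIncidenceSet]
    exact ⟨hfG, hf⟩
  · rw [deleteIncidenceSet_adj]
    exact ⟨hxy, fun h => he ⟨heG, h ▸ hx⟩, fun h => hf ⟨hfG, h ▸ hy⟩⟩

/-- The induction over the subgraphs of `G`. They keep the vertex set `V`, so sparsity is expressed through
the vertices of positive degree. -/
theorem nonempty_coloring_conflictGraph (G : SimpleGraph V)
    (hore : ∀ u v, G.Adj u v → G.degree u + G.degree v ≤ 7)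
    (hsparse : ∀ G' ≤ G, G' ≠ ⊥ → 11 * ∑ v, G'.degree v <
      34 * (Finset.univ.filter fun v => 0 < G'.degree v).card) :
    Nonempty (G.conflictGraph.Coloring (Fin 13)) := by
  induction G using WellFoundedLT.induction with
  | ind G ih =>
    by_contra hcol
    have hbot : G ≠ ⊥ := by
      rintro rfl
      exact hcol ⟨Coloring.mk (fun _ => 0) fun h => by simpa using h.2.1⟩
    have hG : G.IsCritical := by
      refine ⟨hore, fun v hv hext => ?_⟩
      have hsub : ∀ G' < G, Nonempty (G'.conflictGraph.Coloring (Fin 13)) := fun G' hlt =>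
        ih G' hlt
          (fun u w huw => (add_le_add (degree_le_of_le hlt.le) (degree_le_of_le hlt.le)).trans
            (hore u w (hlt.le huw)))
          fun G'' hG'' => hsparse G'' (hG''.trans hlt.le)
      have hlt : G.deleteIncidenceSet v < G := by
        refine lt_of_le_of_ne (G.deleteIncidenceSet_le v) fun h => ?_
        obtain ⟨u, hu⟩ := (G.degree_pos_iff_exists_adj v).1 hv
        rw [← h, deleteIncidenceSet_adj] at hu
        exact hu.2.1 rfl
      obtain ⟨c⟩ := hsub _ hlt
      exact hcol (hext c (properOff_of_deleteIncidenceSet v c))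
    exact absurd hG.card_le_sum_degree (not_le.2 (hsparse G le_rfl hbot))

/-- The average degree of the subgraph formed by the edges of `G'` and their ends is at most the maximum
average degree of `G`. -/
lemma sum_degree_le_mad_mul_card {G' : SimpleGraph V} (hle : G' ≤ G) (hbot : G' ≠ ⊥) :
    (∑ v, (G'.degree v : ℝ)) ≤
      G.mad * (Finset.univ.filter fun v => 0 < G'.degree v).card := by
  obtain ⟨H, hverts, hadj⟩ : ∃ H : G.Subgraph,
      (∀ v, v ∈ H.verts ↔ 0 < G'.degree v) ∧ ∀ u v, H.Adj u v ↔ G'.Adj u v :=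
    ⟨{ verts := {v | 0 < G'.degree v}
       Adj := G'.Adj
       adj_sub := fun h => hle h
       edge_vert := fun h => degree_pos_of_adj h
       symm := G'.symm }, fun _ => Iff.rfl, fun _ _ => Iff.rfl⟩
  have hH : H.verts.Nonempty := by
    obtain ⟨u, v, huv⟩ := ne_bot_iff_exists_adj.1 hbot
    exact ⟨u, (hverts u).2 (degree_pos_of_adj huv)⟩
  have hmem : ∀ v, v ∈ Finset.univ.filter (fun v => 0 < G'.degree v) ↔ v ∈ H.verts := by
    intro v
    rw [Finset.mem_filter, hverts]
    exact ⟨fun h => h.2, fun h => ⟨Finset.mem_univ _, h⟩⟩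
  have hmad : H.coe.avgDegree ≤ G.mad :=
    le_ciSup (f := fun H : {H : G.Subgraph // H.verts.Nonempty} => H.1.coe.avgDegree)
      (Set.finite_range _).bddAbove ⟨H, hH⟩
  have hdeg : ∀ v : H.verts, H.coe.degree v = G'.degree v := by
    intro v
    rw [Subgraph.coe_degree, Subgraph.degree, ← card_neighborSet_eq_degree]
    exact Fintype.card_congr (Equiv.subtypeEquivRight fun u => hadj v u)
  have hsum : ∑ v : H.verts, (H.coe.degree v : ℝ) = ∑ v, (G'.degree v : ℝ) := by
    rw [← Finset.sum_subset (Finset.subset_univ (Finset.univ.filter fun v => 0 < G'.degree v)),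
      Finset.sum_subtype _ hmem]
    · exact Finset.sum_congr rfl fun v _ => by rw [hdeg]
    · intro v _ hv
      simp only [Finset.mem_filter, Finset.mem_univ, true_and, not_lt, Nat.le_zero] at hv
      simp [hv]
  have hcard : Fintype.card H.verts = (Finset.univ.filter fun v => 0 < G'.degree v).card :=
    Fintype.card_of_subtype _ hmem
  have hpos : (0 : ℝ) < Fintype.card H.verts := by
    have := hH.to_subtype
    exact_mod_cast Fintype.card_pos
  rw [avgDegree, div_le_iff₀ hpos] at hmad
  rw [← hsum, ← hcard]
  refine (le_of_eq ?_).trans hmad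
  exact Finset.sum_congr rfl fun v _ => by congr!

lemma degree_add_degree_le_oreDegree [DecidableRel G.Adj] {u v : V} (h : G.Adj u v) :
    G.degree u + G.degree v ≤ G.oreDegree :=
  Finset.le_sup (f := fun p : V × V => G.degree p.1 + G.degree p.2)
    (show (u, v) ∈ Finset.univ.filter fun p : V × V => G.Adj p.1 p.2 by simpa using h)

end Main

end SimpleGraph

theorem theorem1 {V : Type*} [Fintype V] (G : SimpleGraph V) [DecidableRel G.Adj]
    (hore : G.oreDegree ≤ 7) (hmad : G.mad < 34 / 11) :
    G.strongChromaticIndex ≤ 13 := by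
  classical
  refine SimpleGraph.strongChromaticIndex_le (SimpleGraph.nonempty_coloring_conflictGraph G
    (fun u v h => ?_) fun G' hle hbot => ?_)
  · have h7 : G.degree u + G.degree v ≤ 7 :=
      (SimpleGraph.degree_add_degree_le_oreDegree h).trans hore
    convert h7
  · have h1 := SimpleGraph.sum_degree_le_mad_mul_card hle hbot
    obtain ⟨u, v, huv⟩ := SimpleGraph.ne_bot_iff_exists_adj.1 hbot
    have hpos : (0 : ℝ) < (Finset.univ.filter fun v => 0 < G'.degree v).card := by
      exact_mod_cast Finset.card_pos.2 ⟨u, Finset.mem_filter.2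
        ⟨Finset.mem_univ _, SimpleGraph.degree_pos_of_adj huv⟩⟩
    have h2 := mul_lt_mul_of_pos_right hmad hpos
    have h3 : (11 : ℝ) * ∑ v, (G'.degree v : ℝ) <
        34 * (Finset.univ.filter fun v => 0 < G'.degree v).card := by linarith
    exact_mod_cast h3
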